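/- Let $A$ be a commutative ring, let $\mathtt p=X^n+c_1X^{n-1}+\dots+c_n\in A[X]$ be a monic polynomial of degree $n$, and let $0\le k\le n$. Put $M=XA[X]$ and $M(\mathtt p)=M/\mathtt pM$, so that $M=M(0)$, and write $\epsilon^i$ ($i\ge 1$) for the class of $X^i$. For $\mathtt r\in\{0,\mathtt p\}$ let $D_t=\sum_{h\ge 0}D_ht^h:\bigwedge M(\mathtt r)\to(\bigwedge M(\mathtt r))[[t]]$ be the canonical derivation, i.e. the unique $A$-algebra homomorphism with $D_h\epsilon^i=\epsilon^{i+h}$ for all $h\ge 0$, $i\ge 1$. Each $D_h$ maps $\bigwedge^kM(\mathtt r)$ to itself; let $\mathcal A^*(\bigwedge^kM(\mathtt r))\subseteq \mathrm{End}_A(\bigwedge^kM(\mathtt r))$ be the $A$-subalgebra generated by the restrictions of all $D_1,D_2,\dots$ to $\bigwedge^kM(\mathtt r)$. In the polynomial ring $A[T_1,\dots,T_k]$ put $T_0=1$, $T_m=0$ for $m<0$, and $\Delta_h=\det(T_{j+1-i})_{1\le i,j\le h}$ for $0\le h\le k$ (so $\Delta_0=1$). Define $\widetilde D_j\in A[T_1,\dots,T_k]$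 by $$\sum_{j\ge 0}\widetilde D_j\,t^j=\frac1{1-\Delta_1t+\Delta_2t^2-\dots+(-1)^k\Delta_kt^k},$$ and for $n-k+1\le m\le n$ put $$\widetilde D_m(\mathtt p)=\widetilde D_m+\sum_{i=1}^{m}c_i\,\widetilde D_{m-i}.$$ Then: 1. $D_1,\dots,D_k$ are algebraically independent generators of $\mathcal A^*(\bigwedge^kM)$: there is an $A$-algebra isomorphism $A[T_1,\dots,T_k]\cong\mathcal A^*(\bigwedge^kM)$ with $T_i\mapsto D_i$ $(1\le i\le k)$. Thus $\mathcal A^*(\bigwedge^kM)=A[D_1,\dots,D_k]$ is a polynomial ring. 2. There is an $A$-algebra isomorphism $$\frac{A[T_1,\dots,T_k]}{\big(\widetilde D_{n-k+1}(\mathtt p),\dots,\widetilde D_n(\mathtt p)\big)}\;\cong\;\mathcal A^*\Big(\bigwedge^kM(\mathtt p)\Big)$$ sending the class of $T_i$ to $D_i$ for $1\le i\le k$. In particular $\mathcal A^*(\bigwedge^kM(\mathtt p))$ is generated by $D_1,\dots,D_k$. -/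

import Mathlib

open Polynomial

noncomputable section

namespace SchubertCalculus

/-- The `A[X]`-module `M(p) = M / pM`, where `M = X A[X]` is the ideal of `A[X]` generated by `X`.
It is regarded as an `A`-module by restriction of scalars.  For `p = 0` this is `M` itself. -/
abbrev ModP {A : Type*} [CommRing A] (p : A[X]) : Type _ :=
  QuotSMulTop p (Ideal.span {(X : A[X])} : Ideal A[X])

/-- The class `ε^i` of `X ^ i` in `M(p)`, for `i ≥ 1`. -/
def eps {A : Type*} [CommRing A] (p : A[X]) (i : ℕ) (hi : 1 ≤ i) : ModP p :=
  Submodule.Quotient.mk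
    ⟨(X : A[X]) ^ i, Ideal.mem_span_singleton.2 (dvd_pow_self X (Nat.one_le_iff_ne_zero.1 hi))⟩

section Derivation

variable (A N : Type*) [CommRing A] [AddCommGroup N] [Module A N] [Module A[X] N]
  [IsScalarTower A A[X] N]

/-- The `A`-linear map `N → (⋀ N)[[t]]`, `m ↦ ∑_h (X ^ h m) t ^ h`. -/
def genSeries : N →ₗ[A] PowerSeries (ExteriorAlgebra A N) where
  toFun m := PowerSeries.mk fun h => ExteriorAlgebra.ι A ((X : A[X]) ^ h • m)
  map_add' m m' := by
    ext h
    simp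
  map_smul' a m := by
    ext h
    simp [smul_comm _ a m]

theorem genSeries_mul_self (m : N) : genSeries A N m * genSeries A N m = 0 := by
  ext h
  rw [PowerSeries.coeff_mul, map_zero]
  simp only [genSeries, LinearMap.coe_mk, AddHom.coe_mk, PowerSeries.coeff_mk]
  refine Finset.sum_involution (fun x _ => x.swap) ?_ ?_ ?_ ?_
  · intro x _
    exact ExteriorAlgebra.ι_add_mul_swap _ _
  · rintro ⟨a, b⟩ _ hne heq
    simp only [Prod.swap_prod_mk, Prod.mk.injEq] at heq
    apply hne
    simp [heq.1]
  · intro x hx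
    simpa [add_comm] using hx
  · intro x _
    exact Prod.swap_swap x

/-- The canonical derivation `D_t = ∑_h D_h t ^ h : ⋀ N → (⋀ N)[[t]]` of an `A[X]`-module `N`:
the unique `A`-algebra homomorphism which on `N` is `m ↦ ∑_h (X ^ h m) t ^ h`.  For `N = M(p)`
this means `ε^i ↦ ∑_h ε^{i+h} t ^ h`, see `D_eps` below. -/
def derivationSeries :
    ExteriorAlgebra A N →ₐ[A] PowerSeries (ExteriorAlgebra A N) :=
  ExteriorAlgebra.lift A ⟨genSeries A N, genSeries_mul_self A N⟩

/-- The component `D_h` of the canonical derivation, an `A`-endomorphism of `⋀ N`. -/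
def D (h : ℕ) : Module.End A (ExteriorAlgebra A N) where
  toFun α := PowerSeries.coeff h (derivationSeries A N α)
  map_add' α β := by simp
  map_smul' a α := by simp

theorem D_ι (h : ℕ) (m : N) :
    D A N h (ExteriorAlgebra.ι A m) = ExteriorAlgebra.ι A ((X : A[X]) ^ h • m) := by
  simp [D, derivationSeries, genSeries]

/-- Leibniz's rule of order `h`. -/
theorem D_mul (h : ℕ) (α β : ExteriorAlgebra A N) :
    D A N h (α * β) = ∑ x ∈ Finset.HasAntidiagonal.antidiagonal h, D A N x.1 α * D A N x.2 β := by
  simp [D, PowerSeries.coeff_mul]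

theorem D_mem (k h : ℕ) : ∀ α ∈ ⋀[A]^k N, D A N h α ∈ ⋀[A]^k N := by
  induction k generalizing h with
  | zero =>
    intro α hα
    rw [ExteriorAlgebra.exteriorPower, pow_zero, Submodule.mem_one] at hα ⊢
    obtain ⟨a, rfl⟩ := hα
    refine ⟨if h = 0 then a else 0, ?_⟩
    simp only [D, LinearMap.coe_mk, AddHom.coe_mk, AlgHom.commutes, PowerSeries.algebraMap_apply,
      PowerSeries.coeff_C]
    split_ifs <;> simp
  | succ k ih =>
    intro α hα
    rw [ExteriorAlgebra.exteriorPower, pow_succ] at hα ⊢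
    induction hα using Submodule.mul_induction_on' with
    | mem_mul_mem a ha b hb =>
      obtain ⟨m, rfl⟩ := hb
      rw [D_mul]
      refine Submodule.sum_mem _ fun x _ => Submodule.mul_mem_mul (ih _ _ ha) ?_
      exact ⟨_, (D_ι A N x.2 m).symm⟩
    | add a _ b _ h1 h2 =>
      rw [map_add]
      exact Submodule.add_mem _ h1 h2

/-- The restriction of `D_h` to the exterior power `⋀^k N`. -/
def DRes (k h : ℕ) : Module.End A (⋀[A]^k N) :=
  (D A N h).restrict (D_mem A N k h)

end Derivation

/-- The initial conditions `D_h ε^i = ε^{i+h}`. -/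
theorem D_eps {A : Type*} [CommRing A] (p : A[X]) (h i : ℕ) (hi : 1 ≤ i) :
    D A (ModP p) h (ExteriorAlgebra.ι A (eps p i hi)) =
      ExteriorAlgebra.ι A (eps p (i + h) (le_add_right hi)) := by
  rw [D_ι]
  congr 1
  rw [eps, eps, ← Submodule.Quotient.mk_smul]
  congr 1
  ext1
  simp [pow_add, mul_comm]

/-- The ring `𝒜^*(⋀^k M(p))` of all polynomial expressions, with coefficients in `A`, in the
restrictions to `⋀^k M(p)` of all the operators `D_1, D_2, …` (restriction being multiplicative,
this is the ring of restrictions of all polynomial expressions in the `D_h` on `⋀ M(p)`). -/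
def OperatorRing {A : Type*} [CommRing A] (p : A[X]) (k : ℕ) :
    Subalgebra A (Module.End A (⋀[A]^k (ModP p))) :=
  Algebra.adjoin A {f | ∃ h, 1 ≤ h ∧ f = DRes A (ModP p) k h}

section Relations

/-- The Schur determinant `Δ_I(T) = det (T_{i_j - i})_{1 ≤ i, j ≤ l}` for `I = (i_1, …, i_l)`.
Columns are numbered from `0` here, so `I j` is `i_{j+1}`. -/
def schurDet {R : Type*} [CommRing R] (T : ℤ → R) {l : ℕ} (I : Fin l → ℕ) : R :=
  Matrix.det (Matrix.of fun i j : Fin l => T ((I j : ℤ) - ((i : ℕ) + 1)))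

variable (A : Type*) [CommRing A]

/-- The indeterminates of `A[T_1, …, T_k]`, with `T_0 = 1` and `T_m = 0` for `m < 0` (and also
for `m > k`, which never occurs below).  The indeterminate `T_m` is `X (m - 1)`. -/
def indet (k : ℕ) (m : ℤ) : MvPolynomial (Fin k) A :=
  if m = 0 then 1
  else if h : 1 ≤ m ∧ m ≤ k then MvPolynomial.X ⟨(m - 1).toNat, by omega⟩
  else 0

/-- The power series `1 - Δ_(2)(T) t + Δ_(2,3)(T) t^2 - … + (-1)^k Δ_(2,…,k+1)(T) t^k`. -/
def denomSeries (k : ℕ) : PowerSeries (MvPolynomial (Fin k) A) :=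
  PowerSeries.mk fun h =>
    if h ≤ k then (-1) ^ h * schurDet (indet A k) (fun j : Fin h => (j : ℕ) + 2) else 0

/-- The polynomial `D̃_j(T_1, …, T_k)`: the coefficient of `t ^ j` in the inverse of
`denomSeries` (a series with constant coefficient `1`). -/
def Dtilde (k j : ℕ) : MvPolynomial (Fin k) A :=
  PowerSeries.coeff j (PowerSeries.invOfUnit (denomSeries A k) 1)

theorem denomSeries_mul_inv (k : ℕ) :
    denomSeries A k * PowerSeries.invOfUnit (denomSeries A k) 1 = 1 := by
  apply PowerSeries.mul_invOfUnit
  simp [denomSeries, schurDet, ← PowerSeries.coeff_zero_eq_constantCoeff_apply]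

variable {A}

/-- The coefficient `c_i` of `p = X ^ n + c_1 X ^ (n-1) + … + c_n`, with `c_i = 0` for `i > n`. -/
def lowCoeff (p : A[X]) (i : ℕ) : A :=
  if i ≤ p.natDegree then p.coeff (p.natDegree - i) else 0

/-- `D̃_m(T_1, …, T_k; p) = D̃_m + ∑_{i=1}^m c_i D̃_{m-i}`. -/
def DtildeP (p : A[X]) (k m : ℕ) : MvPolynomial (Fin k) A :=
  Dtilde A k m + ∑ i ∈ Finset.Icc 1 m, MvPolynomial.C (lowCoeff p i) * Dtilde A k (m - i)

/-- The ideal of `A[T_1, …, T_k]` generated by `D̃_{n-k+1}(p), …, D̃_n(p)`, where `n` is the degree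
of `p` and `k ≤ n`. -/
def relIdeal (p : A[X]) (k : ℕ) : Ideal (MvPolynomial (Fin k) A) :=
  Ideal.span {f | ∃ j, 1 ≤ j ∧ j ≤ k ∧ f = DtildeP p k (p.natDegree - k + j)}

end Relations

end SchubertCalculus

end

/-!
On `⋀^k N` the series `D_t` is invertible: its inverse `E_t` extends `m ↦ m - (X m) t`
multiplicatively, hence is a polynomial in `t` of degree at most `k`. So every `D_h` is the
universal polynomial `D̃_h` in `D_1, …, D_k`, and evaluation at `D_1, …, D_k` maps
`A[T_1, …, T_k]` onto the operator ring.

If `N` is generated by `g` over `A[X]`, then `⋀^k N` is generated over the operators by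
`g ∧ X g ∧ ⋯ ∧ X^(k-1) g`: applying `D_s` to this wedge replaces the last factor by `X^(k-1+s) g`,
and the other factors are reached by `D_s α ∧ β = ∑ D_i (α ∧ E_(s-i) β)`. If `p g = 0`, the
combination `∑ c_i D_(m-i)` kills the wedge for `n - k < m ≤ n`; these are the relations.

Conversely, `X^k - Δ_1 X^(k-1) + ⋯ ± Δ_k` over `A[T_1, …, T_k]` is the generic monic polynomial of
degree `k`, and it divides `p` modulo the relations. Hence, with `S` the quotient of
`A[T_1, …, T_k]` by the relations (or `A[T_1, …, T_k]` itself if `p = 0`), `M(p)` maps to `S[X]`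
modulo the generic divisor, which is free of rank `k`. On the determinant of this module `E_t` acts
as the reversed characteristic polynomial `1 - Δ_1 t + Δ_2 t^2 - ⋯`, so the determinant of
`f(D_1, …, D_k)` applied to the wedge is the class of `f` in `S`. Thus `f(D_1, …, D_k) = 0` forces
this class to vanish.
-/

noncomputable section

namespace SchubertCalculus

open scoped Matrix

section PowerSeries

theorem coeff_eq_of_inverses_agree {R : Type*} [Semiring R] {d e d' e' : PowerSeries R} {n : ℕ}
    (hde : d * e = 1) (hed' : e' * d' = 1)
    (hagree : ∀ m < n, PowerSeries.coeff m e = PowerSeries.coeff m e') :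
    ∀ m < n, PowerSeries.coeff m d = PowerSeries.coeff m d' := by
  intro m hm
  calc PowerSeries.coeff m d = PowerSeries.coeff m (d * (e' * d')) := by rw [hed', mul_one]
    _ = PowerSeries.coeff m (d * (e * d')) := by
        simp only [PowerSeries.coeff_mul]
        refine Finset.sum_congr rfl fun x hx => congrArg _ (Finset.sum_congr rfl fun y hy => ?_)
        rw [Finset.HasAntidiagonal.mem_antidiagonal] at hx hy
        rw [hagree y.1 (by omega)]
    _ = PowerSeries.coeff m d' := by rw [← mul_assoc, hde, one_mul]

/-- The triangular Toeplitz matrix of multiplication by `∑ T_m t ^ m` modulo `t ^ l`. -/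
def toeplitz {R : Type*} (T : ℤ → R) (l : ℕ) : Matrix (Fin l) (Fin l) R :=
  Matrix.of fun i j => T ((i : ℤ) - j)

variable {R : Type*} [CommRing R] {T : ℤ → R}

theorem det_toeplitz (h0 : T 0 = 1) (hneg : ∀ m < 0, T m = 0) (l : ℕ) :
    (toeplitz T l).det = 1 := by
  rw [Matrix.det_of_isLowerTriangular]
  · simp [toeplitz, h0]
  · intro i j hij
    exact hneg _ (sub_neg.2 (by exact_mod_cast hij))

theorem toeplitz_mulVec_coeff (hneg : ∀ m < 0, T m = 0) {g : PowerSeries R}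
    (hg : (PowerSeries.mk fun m : ℕ => T m) * g = 1) (l : ℕ) :
    toeplitz T (l + 1) *ᵥ (fun i => PowerSeries.coeff (i : ℕ) g) = Pi.single 0 1 := by
  ext i
  have hcoeff : ∑ j ∈ Finset.range (i + 1), PowerSeries.coeff j g * T ((i - j : ℕ) : ℤ) =
      if (i : ℕ) = 0 then 1 else 0 := by
    rw [← PowerSeries.coeff_one, ← hg, mul_comm, PowerSeries.coeff_mul,
      Finset.Nat.sum_antidiagonal_eq_sum_range_succ_mk]
    simp only [PowerSeries.coeff_mk]
  calc ∑ j : Fin (l + 1), T ((i : ℤ) - j) * PowerSeries.coeff (j : ℕ) g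
      = ∑ j ∈ Finset.range (l + 1), T ((i : ℤ) - j) * PowerSeries.coeff j g :=
        Fin.sum_univ_eq_sum_range (fun j => T ((i : ℤ) - j) * PowerSeries.coeff j g) (l + 1)
    _ = ∑ j ∈ Finset.range (i + 1), T ((i : ℤ) - j) * PowerSeries.coeff j g := by
        refine (Finset.sum_subset (Finset.range_mono i.isLt) fun j _ hj => ?_).symm
        rw [hneg _ (by simp only [Finset.mem_range] at hj; omega), zero_mul]
    _ = ∑ j ∈ Finset.range (i + 1), PowerSeries.coeff j g * T ((i - j : ℕ) : ℤ) := by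
        refine Finset.sum_congr rfl fun j hj => ?_
        rw [Nat.cast_sub (Finset.mem_range_succ_iff.1 hj), mul_comm]
    _ = (Pi.single 0 1 : Fin (l + 1) → R) i := by
        rw [hcoeff, Pi.single_apply]
        simp only [Fin.ext_iff, Fin.val_zero]

theorem coeff_eq_schurDet_of_mul_eq_one (h0 : T 0 = 1) (hneg : ∀ m < 0, T m = 0)
    {g : PowerSeries R} (hg : (PowerSeries.mk fun m : ℕ => T m) * g = 1) (h : ℕ) :
    PowerSeries.coeff h g = (-1) ^ h * schurDet T fun j : Fin h => (j : ℕ) + 2 := by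
  have hsolve := congrArg ((toeplitz T (h + 1)).adjugate *ᵥ ·) (toeplitz_mulVec_coeff hneg hg h)
  simp only [Matrix.mulVec_mulVec, Matrix.adjugate_mul, det_toeplitz h0 hneg, one_smul,
    Matrix.one_mulVec, Matrix.mulVec_single_one] at hsolve
  have hlast := congrFun hsolve (Fin.last h)
  simp only [Fin.val_last, Matrix.col_apply, Matrix.adjugate_fin_succ_eq_det_submatrix] at hlast
  rw [hlast, ← Matrix.det_transpose, schurDet]
  simp only [Fin.val_zero, zero_add]
  congr 2
  ext i j
  simp only [toeplitz, Matrix.transpose_apply, Matrix.submatrix_apply, Matrix.of_apply,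
    Fin.zero_succAbove, Fin.succAbove_last]
  refine congrArg T ?_
  simp only [Fin.val_succ, Nat.cast_add, Nat.cast_one, Fin.val_castSucc, Nat.cast_ofNat]
  ring

end PowerSeries

section UniversalPolynomials

variable (A : Type*) [CommRing A] {k h : ℕ}

theorem indet_zero : indet A k 0 = 1 :=
  if_pos rfl

theorem indet_of_neg {m : ℤ} (hm : m < 0) : indet A k m = 0 := by
  rw [indet, if_neg hm.ne, dif_neg (by omega)]

theorem indet_succ (i : Fin k) : indet A k ((i : ℕ) + 1 : ℕ) = MvPolynomial.X i := by
  rw [indet, if_neg (by omega), dif_pos (by omega)]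
  congr 1
  ext
  simp

theorem coeff_denomSeries_of_le (hh : h ≤ k) :
    PowerSeries.coeff h (denomSeries A k) =
      (-1) ^ h * schurDet (indet A k) fun j : Fin h => (j : ℕ) + 2 := by
  rw [denomSeries, PowerSeries.coeff_mk, if_pos hh]

theorem coeff_denomSeries_of_lt (hh : k < h) : PowerSeries.coeff h (denomSeries A k) = 0 := by
  rw [denomSeries, PowerSeries.coeff_mk, if_neg hh.not_ge]

theorem coeff_zero_denomSeries : PowerSeries.coeff 0 (denomSeries A k) = 1 := by
  simp [denomSeries, schurDet]

theorem mk_Dtilde_mul_denomSeries : PowerSeries.mk (Dtilde A k) * denomSeries A k = 1 := by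
  rw [mul_comm, ← denomSeries_mul_inv A k]
  congr 1
  ext1 j
  rw [PowerSeries.coeff_mk, Dtilde]

theorem Dtilde_eq_indet (hh : h ≤ k) : Dtilde A k h = indet A k h := by
  let τ : PowerSeries (MvPolynomial (Fin k) A) := PowerSeries.mk fun m : ℕ => indet A k m
  have hinv : τ * τ.invOfUnit 1 = 1 := by
    apply PowerSeries.mul_invOfUnit
    rw [← PowerSeries.coeff_zero_eq_constantCoeff_apply, PowerSeries.coeff_mk, Nat.cast_zero,
      indet_zero, Units.val_one]
  have hdenom : ∀ m < k + 1,
      PowerSeries.coeff m (denomSeries A k) = PowerSeries.coeff m (τ.invOfUnit 1) := fun m hm => by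
    rw [coeff_denomSeries_of_le A (Nat.lt_succ_iff.1 hm), coeff_eq_schurDet_of_mul_eq_one
      (indet_zero A) (fun _ => indet_of_neg A) hinv]
  have hτ := coeff_eq_of_inverses_agree (mk_Dtilde_mul_denomSeries A)
    (by rw [mul_comm, hinv]) hdenom h (Nat.lt_succ_iff.2 hh)
  rwa [PowerSeries.coeff_mk, PowerSeries.coeff_mk] at hτ

theorem Dtilde_zero : Dtilde A k 0 = 1 := by
  rw [Dtilde_eq_indet A (Nat.zero_le k), Nat.cast_zero, indet_zero]

theorem Dtilde_succ (i : Fin k) : Dtilde A k ((i : ℕ) + 1) = MvPolynomial.X i := by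
  rw [Dtilde_eq_indet A i.isLt, indet_succ]

end UniversalPolynomials

section InverseDerivation

variable (A N : Type*) [CommRing A] [AddCommGroup N] [Module A N] [Module A[X] N]
  [IsScalarTower A A[X] N]

/-- The map `m ↦ m - (X m) t`, the restriction to `N` of the inverse of the canonical
derivation. -/
def inverseGen : N →ₗ[A] (ExteriorAlgebra A N)[X] :=
  (monomial 0).restrictScalars A ∘ₗ ExteriorAlgebra.ι A -
    (monomial 1).restrictScalars A ∘ₗ ExteriorAlgebra.ι A ∘ₗ Algebra.lsmul A A N (X : A[X])

theorem inverseGen_apply (m : N) :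
    inverseGen A N m = monomial 0 (ExteriorAlgebra.ι A m) -
      monomial 1 (ExteriorAlgebra.ι A ((X : A[X]) • m)) :=
  rfl

theorem inverseGen_mul_self (m : N) : inverseGen A N m * inverseGen A N m = 0 := by
  simp only [inverseGen_apply, sub_mul, mul_sub, monomial_mul_monomial,
    ExteriorAlgebra.ι_sq_zero, map_zero, zero_sub, sub_zero, zero_add, add_zero]
  rw [← neg_add', ← map_add, ExteriorAlgebra.ι_add_mul_swap, map_zero, neg_zero]

/-- The inverse of the canonical derivation: the `A`-algebra homomorphism `⋀ N → (⋀ N)[t]` which on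
`N` is `m ↦ m - (X m) t`. -/
def inverseDerivation : ExteriorAlgebra A N →ₐ[A] (ExteriorAlgebra A N)[X] :=
  ExteriorAlgebra.lift A ⟨inverseGen A N, inverseGen_mul_self A N⟩

theorem inverseDerivation_ι (m : N) :
    inverseDerivation A N (ExteriorAlgebra.ι A m) = monomial 0 (ExteriorAlgebra.ι A m) -
      monomial 1 (ExteriorAlgebra.ι A ((X : A[X]) • m)) := by
  rw [inverseDerivation, ExteriorAlgebra.lift_ι_apply, inverseGen_apply]

/-- The component of degree `h` of the inverse of the canonical derivation. -/
def E (h : ℕ) : Module.End A (ExteriorAlgebra A N) :=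
  (lcoeff (ExteriorAlgebra A N) h).restrictScalars A ∘ₗ (inverseDerivation A N).toLinearMap

theorem E_apply (h : ℕ) (α : ExteriorAlgebra A N) :
    E A N h α = (inverseDerivation A N α).coeff h :=
  rfl

theorem coeff_derivationSeries (h : ℕ) (α : ExteriorAlgebra A N) :
    PowerSeries.coeff h (derivationSeries A N α) = D A N h α :=
  rfl

/-- The extension of the canonical derivation to polynomials, with `t ↦ t`. -/
def extendedDerivation : (ExteriorAlgebra A N)[X] →+* PowerSeries (ExteriorAlgebra A N) :=
  eval₂RingHom' (derivationSeries A N : ExteriorAlgebra A N →+* _) PowerSeries.X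
    fun _ => PowerSeries.commute_X _

theorem extendedDerivation_monomial (n : ℕ) (α : ExteriorAlgebra A N) :
    extendedDerivation A N (monomial n α) = derivationSeries A N α * PowerSeries.X ^ n :=
  eval₂_monomial _ _

theorem coeff_extendedDerivation (s : ℕ) (P : (ExteriorAlgebra A N)[X]) :
    PowerSeries.coeff s (extendedDerivation A N P) =
      ∑ x ∈ Finset.HasAntidiagonal.antidiagonal s, D A N x.1 (P.coeff x.2) := by
  induction P using Polynomial.induction_on' with
  | add P Q hP hQ => simp only [map_add, hP, hQ, coeff_add, Finset.sum_add_distrib]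
  | monomial n α =>
    rw [extendedDerivation_monomial, PowerSeries.coeff_mul_X_pow', coeff_derivationSeries]
    simp only [coeff_monomial, apply_ite (D A N _), map_zero]
    simp only [eq_comm (a := n)]
    rw [← Finset.sum_filter, Finset.HasAntidiagonal.filter_snd_eq_antidiagonal s n]
    split_ifs
    · rw [Finset.sum_singleton]
    · rw [Finset.sum_empty]

theorem extendedDerivation_inverseDerivation (α : ExteriorAlgebra A N) :
    extendedDerivation A N (inverseDerivation A N α) = PowerSeries.C α := by
  induction α using ExteriorAlgebra.induction with
  | algebraMap a =>
    rw [AlgHom.commutes, Polynomial.algebraMap_apply, ← monomial_zero_left,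
      extendedDerivation_monomial, pow_zero, mul_one, AlgHom.commutes,
      PowerSeries.algebraMap_apply]
  | ι m =>
    rw [inverseDerivation_ι, map_sub, extendedDerivation_monomial, extendedDerivation_monomial]
    ext (_ | h)
    · rw [map_sub, pow_zero, mul_one, pow_one, PowerSeries.coeff_zero_mul_X, coeff_derivationSeries,
        D_ι, pow_zero, one_smul, sub_zero, PowerSeries.coeff_zero_C]
    · rw [map_sub, pow_zero, mul_one, pow_one, PowerSeries.coeff_succ_mul_X, coeff_derivationSeries,
        coeff_derivationSeries, D_ι, D_ι, smul_smul, ← pow_succ, sub_self,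
        PowerSeries.coeff_C, if_neg h.succ_ne_zero]
  | mul α β hα hβ => rw [map_mul, map_mul, hα, hβ, map_mul]
  | add α β hα hβ => rw [map_add, map_add, hα, hβ, map_add]

theorem D_mul_eq_sum_D_mul_E (s : ℕ) (α β : ExteriorAlgebra A N) :
    D A N s α * β =
      ∑ x ∈ Finset.HasAntidiagonal.antidiagonal s, D A N x.1 (α * E A N x.2 β) := by
  have hprod : extendedDerivation A N (C α * inverseDerivation A N β) =
      derivationSeries A N α * PowerSeries.C β := by
    rw [map_mul, extendedDerivation_inverseDerivation, ← monomial_zero_left,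
      extendedDerivation_monomial, pow_zero, mul_one]
  have hcoeff := congrArg (PowerSeries.coeff s) hprod
  rw [coeff_extendedDerivation, PowerSeries.coeff_mul_C, coeff_derivationSeries] at hcoeff
  simp only [hcoeff.symm, coeff_C_mul, E_apply]

theorem D_algebraMap (h : ℕ) (a : A) :
    D A N h (algebraMap A _ a) = if h = 0 then algebraMap A _ a else 0 := by
  rw [← coeff_derivationSeries, AlgHom.commutes, PowerSeries.algebraMap_apply, PowerSeries.coeff_C]

theorem D_one (h : ℕ) : D A N h 1 = if h = 0 then 1 else 0 := by
  simpa only [map_one] using D_algebraMap A N h 1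

theorem sum_D_E (h : ℕ) (α : ExteriorAlgebra A N) :
    ∑ x ∈ Finset.HasAntidiagonal.antidiagonal h, D A N x.1 (E A N x.2 α) =
      if h = 0 then α else 0 := by
  have hsum := D_mul_eq_sum_D_mul_E A N h 1 α
  simp only [one_mul, D_one, ite_mul, zero_mul] at hsum
  exact hsum.symm

theorem prod_ofFn_monomial {R : Type*} [Semiring R] {k : ℕ} (e : Fin k → ℕ) (c : Fin k → R) :
    (List.ofFn fun i => monomial (e i) (c i)).prod = monomial (∑ i, e i) (List.ofFn c).prod := by
  induction k with
  | zero => simp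
  | succ k ih =>
    rw [List.ofFn_succ, List.prod_cons, ih, monomial_mul_monomial, ← Fin.sum_univ_succ,
      List.ofFn_succ, List.prod_cons]

theorem inverseDerivation_ιMulti {k : ℕ} (v : Fin k → N) :
    inverseDerivation A N (ExteriorAlgebra.ιMulti A k v) =
      ∑ s : Finset (Fin k), monomial s.card
        (ExteriorAlgebra.ιMulti A k (s.piecewise (fun i => -((X : A[X]) • v i)) v)) := by
  have hι : ∀ i, inverseDerivation A N (ExteriorAlgebra.ι A (v i)) =
      monomial 1 (ExteriorAlgebra.ι A (-((X : A[X]) • v i))) +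
        monomial 0 (ExteriorAlgebra.ι A (v i)) := fun i => by
    rw [inverseDerivation_ι, map_neg, map_neg, sub_eq_neg_add]
  rw [ExteriorAlgebra.ιMulti_apply, map_list_prod, List.map_ofFn]
  simp only [Function.comp_def, hι]
  have hadd := (MultilinearMap.mkPiAlgebraFin A k (ExteriorAlgebra A N)[X]).map_add_univ
    (fun i => monomial 1 (ExteriorAlgebra.ι A (-((X : A[X]) • v i))))
    (fun i => monomial 0 (ExteriorAlgebra.ι A (v i)))
  simp only [MultilinearMap.mkPiAlgebraFin_apply] at hadd
  refine hadd.trans (Finset.sum_congr rfl fun s _ => ?_)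
  have hpiece : s.piecewise
      (fun i => monomial 1 (ExteriorAlgebra.ι A (-((X : A[X]) • v i))))
      (fun i => monomial 0 (ExteriorAlgebra.ι A (v i))) =
        fun i => monomial (if i ∈ s then 1 else 0)
          (ExteriorAlgebra.ι A (s.piecewise (fun i => -((X : A[X]) • v i)) v i)) := by
    ext1 i
    simp only [Finset.piecewise]
    split_ifs <;> rfl
  rw [hpiece, prod_ofFn_monomial, ExteriorAlgebra.ιMulti_apply, Finset.sum_boole,
    Finset.filter_univ_mem, Nat.cast_id]

theorem E_ιMulti {k : ℕ} (h : ℕ) (v : Fin k → N) :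
    E A N h (ExteriorAlgebra.ιMulti A k v) =
      ∑ s ∈ Finset.powersetCard h Finset.univ,
        ExteriorAlgebra.ιMulti A k (s.piecewise (fun i => -((X : A[X]) • v i)) v) := by
  rw [E_apply, inverseDerivation_ιMulti, finsetSum_coeff]
  simp only [coeff_monomial]
  rw [Finset.powersetCard_eq_filter, Finset.sum_filter, Finset.powerset_univ]

end InverseDerivation

section OperatorEvaluation

variable (A N : Type*) [CommRing A] [AddCommGroup N] [Module A N] [Module A[X] N]
  [IsScalarTower A A[X] N] (k : ℕ)

theorem D_comm (h l : ℕ) (α : ExteriorAlgebra A N) :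
    D A N h (D A N l α) = D A N l (D A N h α) := by
  induction α using ExteriorAlgebra.induction generalizing h l with
  | algebraMap a =>
    simp only [D_algebraMap, apply_ite (D A N _), map_zero]
    split_ifs <;> rfl
  | ι m => simp only [D_ι, smul_smul, ← pow_add, add_comm]
  | mul α β hα hβ =>
    simp only [D_mul, map_sum]
    rw [Finset.sum_comm]
    simp only [hα, hβ]
  | add α β hα hβ => simp only [map_add, hα, hβ]

theorem D_zero_apply (α : ExteriorAlgebra A N) : D A N 0 α = α := by
  induction α using ExteriorAlgebra.induction with
  | algebraMap a => rw [D_algebraMap, if_pos rfl]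
  | ι m => rw [D_ι, pow_zero, one_smul]
  | mul α β hα hβ =>
    rw [D_mul, Finset.Nat.antidiagonal_zero, Finset.sum_singleton, hα, hβ]
  | add α β hα hβ => rw [map_add, hα, hβ]

theorem E_mem (h : ℕ) : ∀ α ∈ ⋀[A]^k N, E A N h α ∈ ⋀[A]^k N := by
  rw [← ExteriorAlgebra.ιMulti_span_fixedDegree]
  refine Submodule.span_le (p := (Submodule.span A _).comap (E A N h)).2 ?_
  rintro _ ⟨v, rfl⟩
  rw [SetLike.mem_coe, Submodule.mem_comap, E_ιMulti]
  exact Submodule.sum_mem _ fun s _ => Submodule.subset_span ⟨_, rfl⟩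

theorem E_eq_zero_of_lt {k h : ℕ} (hkh : k < h) : ∀ α ∈ ⋀[A]^k N, E A N h α = 0 := by
  rw [← ExteriorAlgebra.ιMulti_span_fixedDegree]
  refine Submodule.span_le (p := LinearMap.ker (E A N h)).2 ?_
  rintro _ ⟨v, rfl⟩
  rw [SetLike.mem_coe, LinearMap.mem_ker, E_ιMulti,
    Finset.powersetCard_eq_empty.2 (by rwa [Finset.card_fin]), Finset.sum_empty]

/-- The restriction of `E_h` to the exterior power `⋀^k N`. -/
def ERes (h : ℕ) : Module.End A (⋀[A]^k N) :=
  (E A N h).restrict (E_mem A N k h)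

theorem ERes_ιMulti (h : ℕ) (v : Fin k → N) :
    ERes A N k h (exteriorPower.ιMulti A k v) = ∑ s ∈ Finset.powersetCard h Finset.univ,
      exteriorPower.ιMulti A k (s.piecewise (fun i => -((X : A[X]) • v i)) v) := by
  refine Subtype.ext ((E_ιMulti A N h v).trans ?_)
  rw [Submodule.coe_sum]
  rfl

theorem mk_DRes_mul_mk_ERes :
    PowerSeries.mk (DRes A N k) * PowerSeries.mk (ERes A N k) = 1 := by
  refine PowerSeries.ext fun h => LinearMap.ext fun α => Subtype.ext ?_
  rw [PowerSeries.coeff_mul, PowerSeries.coeff_one, LinearMap.sum_apply, Submodule.coe_sum]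
  simp only [PowerSeries.coeff_mk]
  refine (sum_D_E A N h (α : ExteriorAlgebra A N)).trans ?_
  split_ifs <;> rfl

theorem DRes_zero : DRes A N k 0 = 1 :=
  LinearMap.ext fun _ => Subtype.ext (D_zero_apply A N _)

/-- The algebra generated by the restrictions of the operators `D_1, D_2, …` to `⋀^k N`. For
`N = M(p)` it is definitionally `OperatorRing p k`. -/
def opRing : Subalgebra A (Module.End A (⋀[A]^k N)) :=
  Algebra.adjoin A {f | ∃ h, 1 ≤ h ∧ f = DRes A N k h}

instance : IsMulCommutative (opRing A N k) := by
  refine Algebra.isMulCommutative_adjoin A ?_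
  rintro _ ⟨h, -, rfl⟩ _ ⟨l, -, rfl⟩
  exact LinearMap.ext fun _ => Subtype.ext (D_comm A N h l _)

open scoped IsMulCommutative in
/-- Evaluation of a polynomial at the restrictions of `D_1, …, D_k` to `⋀^k N`. As the
endomorphism ring is not commutative, it is defined through the commutative algebra `opRing`. -/
def opEval : MvPolynomial (Fin k) A →ₐ[A] Module.End A (⋀[A]^k N) :=
  (opRing A N k).val.comp <| MvPolynomial.aeval fun i =>
    ⟨DRes A N k (i + 1), Algebra.subset_adjoin ⟨i + 1, Nat.le_add_left 1 i, rfl⟩⟩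

theorem opEval_X (i : Fin k) :
    opEval A N k (MvPolynomial.X i) = DRes A N k (i + 1) := by
  simp [opEval]

theorem opEval_mem_opRing (f : MvPolynomial (Fin k) A) : opEval A N k f ∈ opRing A N k :=
  Subtype.property _

theorem opEval_Dtilde_of_le {h : ℕ} (hh : h ≤ k) :
    opEval A N k (Dtilde A k h) = DRes A N k h := by
  rcases h with _ | h
  · rw [Dtilde_zero, map_one, DRes_zero]
  · rw [Dtilde_succ A ⟨h, hh⟩, opEval_X]

theorem map_denomSeries_mul_map_Dtilde :
    PowerSeries.map (opEval A N k).toRingHom (denomSeries A k) *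
      PowerSeries.map (opEval A N k).toRingHom (PowerSeries.mk (Dtilde A k)) = 1 := by
  rw [← map_mul, mul_comm, mk_Dtilde_mul_denomSeries, map_one]

theorem map_opEval_denomSeries :
    PowerSeries.map (opEval A N k).toRingHom (denomSeries A k) = PowerSeries.mk (ERes A N k) := by
  ext1 h
  rcases le_or_gt h k with hh | hh
  · have hagree : ∀ m < k + 1, PowerSeries.coeff m
        (PowerSeries.map (opEval A N k).toRingHom (PowerSeries.mk (Dtilde A k))) =
          PowerSeries.coeff m (PowerSeries.mk (DRes A N k)) := fun m hm => by
      rw [PowerSeries.coeff_map, PowerSeries.coeff_mk, PowerSeries.coeff_mk]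
      exact opEval_Dtilde_of_le A N k (Nat.lt_succ_iff.1 hm)
    exact coeff_eq_of_inverses_agree (map_denomSeries_mul_map_Dtilde A N k)
      (mk_DRes_mul_mk_ERes A N k) hagree h (Nat.lt_succ_iff.2 hh)
  · rw [PowerSeries.coeff_map, coeff_denomSeries_of_lt A hh, map_zero, PowerSeries.coeff_mk]
    exact LinearMap.ext fun α => Subtype.ext (E_eq_zero_of_lt A N hh α α.2).symm

theorem opEval_Dtilde (h : ℕ) : opEval A N k (Dtilde A k h) = DRes A N k h := by
  have hinv := map_denomSeries_mul_map_Dtilde A N k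
  rw [map_opEval_denomSeries] at hinv
  have hD := congrArg (PowerSeries.coeff h) (left_inv_eq_right_inv (mk_DRes_mul_mk_ERes A N k) hinv)
  rwa [PowerSeries.coeff_map, PowerSeries.coeff_mk, PowerSeries.coeff_mk, eq_comm] at hD

theorem mk_ERes_mul_mk_DRes :
    PowerSeries.mk (ERes A N k) * PowerSeries.mk (DRes A N k) = 1 := by
  rw [← map_denomSeries_mul_map_Dtilde A N k, map_opEval_denomSeries]
  congr 1
  ext1 h
  rw [PowerSeries.coeff_map, PowerSeries.coeff_mk, PowerSeries.coeff_mk]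
  exact (opEval_Dtilde A N k h).symm

theorem range_opEval : (opEval A N k).range = opRing A N k := by
  refine le_antisymm ?_ (Algebra.adjoin_le ?_)
  · rintro _ ⟨f, rfl⟩
    exact opEval_mem_opRing A N k f
  · rintro _ ⟨h, -, rfl⟩
    exact ⟨Dtilde A k h, opEval_Dtilde A N k h⟩

theorem exists_algEquiv_opRing_of_injective (hinj : Function.Injective (opEval A N k)) :
    ∃ Ψ : MvPolynomial (Fin k) A ≃ₐ[A] opRing A N k, ∀ i : Fin k,
      (Ψ (MvPolynomial.X i) : Module.End A (⋀[A]^k N)) = DRes A N k (i + 1) :=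
  ⟨(AlgEquiv.ofInjective _ hinj).trans (Subalgebra.equivOfEq _ _ (range_opEval A N k)),
    opEval_X A N k⟩

theorem exists_algEquiv_opRing_of_ker_eq {I : Ideal (MvPolynomial (Fin k) A)}
    (hI : RingHom.ker (opEval A N k) = I) :
    ∃ Φ : (MvPolynomial (Fin k) A ⧸ I) ≃ₐ[A] opRing A N k, ∀ i : Fin k,
      (Φ (Ideal.Quotient.mk I (MvPolynomial.X i)) : Module.End A (⋀[A]^k N)) =
        DRes A N k (i + 1) := by
  subst hI
  exact ⟨(Ideal.quotientKerEquivRange (opEval A N k)).trans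
    (Subalgebra.equivOfEq _ _ (range_opEval A N k)), opEval_X A N k⟩

end OperatorEvaluation

section CyclicModules

variable (A : Type*) {N : Type*} [CommRing A] [AddCommGroup N] [Module A N] [Module A[X] N]

/-- The wedge product `g ∧ X g ∧ … ∧ X ^ (k - 1) g`. -/
def powWedge (g : N) : ℕ → ExteriorAlgebra A N
  | 0 => 1
  | k + 1 => powWedge g k * ExteriorAlgebra.ι A ((X : A[X]) ^ k • g)

theorem powWedge_mem (g : N) (k : ℕ) : powWedge A g k ∈ ⋀[A]^k N := by
  induction k with
  | zero => simp [powWedge, ExteriorAlgebra.exteriorPower, Submodule.mem_one]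
  | succ k ih =>
    rw [ExteriorAlgebra.exteriorPower, pow_succ]
    exact Submodule.mul_mem_mul ih ⟨_, rfl⟩

theorem powWedge_eq_ιMulti (g : N) (k : ℕ) :
    powWedge A g k = ExteriorAlgebra.ιMulti A k fun i => (X : A[X]) ^ (i : ℕ) • g := by
  induction k with
  | zero => simp [powWedge]
  | succ k ih =>
    rw [powWedge, ih, ExteriorAlgebra.ιMulti_apply, ExteriorAlgebra.ιMulti_apply, List.ofFn_succ',
      List.concat_eq_append, List.prod_append, List.prod_singleton, Fin.val_last]
    rfl

theorem powWedge_mul_ι_of_lt (g : N) {i k : ℕ} (hik : i < k) :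
    powWedge A g k * ExteriorAlgebra.ι A ((X : A[X]) ^ i • g) = 0 := by
  induction k with
  | zero => omega
  | succ k ih =>
    rw [powWedge, mul_assoc]
    rcases Nat.lt_succ_iff_lt_or_eq.1 hik with hik | rfl
    · rw [eq_neg_of_add_eq_zero_left (ExteriorAlgebra.ι_add_mul_swap _ _), mul_neg, ← mul_assoc,
        ih hik, zero_mul, neg_zero]
    · rw [ExteriorAlgebra.ι_sq_zero, mul_zero]

variable [IsScalarTower A A[X] N]

theorem D_powWedge_succ (g : N) (h k : ℕ) :
    D A N h (powWedge A g (k + 1)) =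
      powWedge A g k * ExteriorAlgebra.ι A ((X : A[X]) ^ (k + h) • g) := by
  induction k generalizing h with
  | zero => simp [powWedge, D_ι]
  | succ k ih =>
    have hsq := congrArg (PowerSeries.coeff (h + 1)) (genSeries_mul_self A N ((X : A[X]) ^ k • g))
    rw [PowerSeries.coeff_mul, map_zero, Finset.Nat.sum_antidiagonal_succ'] at hsq
    simp only [genSeries, LinearMap.coe_mk, AddHom.coe_mk, PowerSeries.coeff_mk, smul_smul,
      ← pow_add] at hsq
    rw [powWedge, D_mul]
    simp only [ih, D_ι, smul_smul, ← pow_add, mul_assoc]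
    rw [← Finset.mul_sum, powWedge, mul_assoc, show k + 1 + h = h + 1 + k by ring,
      eq_neg_of_add_eq_zero_left (ExteriorAlgebra.ι_add_mul_swap ((X : A[X]) ^ k • g) _),
      ← eq_neg_of_add_eq_zero_right (by simpa only [zero_add] using hsq)]
    congr 1
    refine Finset.sum_congr rfl fun x _ => ?_
    rw [add_comm k x.1, show x.2 + (k + 1) = x.2 + 1 + k by ring]

variable {A} {W : Submodule A (ExteriorAlgebra A N)}

theorem powWedge_mul_ι_mul_mem (hW : ∀ h, ∀ w ∈ W, D A N h w ∈ W) (g : N) {k : ℕ}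
    {γ : ExteriorAlgebra A N} (hγ : ∀ h, powWedge A g (k + 1) * E A N h γ ∈ W) (q : A[X]) :
    powWedge A g k * (ExteriorAlgebra.ι A (q • g) * γ) ∈ W := by
  induction q using Polynomial.induction_on' with
  | add q r hq hr =>
    rw [add_smul, map_add, add_mul, mul_add]
    exact add_mem hq hr
  | monomial i a =>
    rw [← smul_X_eq_monomial, smul_assoc, map_smul, smul_mul_assoc, mul_smul_comm, ← mul_assoc]
    refine Submodule.smul_mem _ _ ?_
    rcases lt_or_ge i k with hik | hki
    · rw [powWedge_mul_ι_of_lt A g hik, zero_mul]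
      exact zero_mem _
    · obtain ⟨s, rfl⟩ := Nat.exists_eq_add_of_le hki
      rw [← D_powWedge_succ, D_mul_eq_sum_D_mul_E]
      exact sum_mem fun x _ => hW _ _ (hγ _)

theorem exteriorPower_le_of_powWedge_mem (hW : ∀ h, ∀ w ∈ W, D A N h w ∈ W) {g : N}
    (hg : Submodule.span A[X] {g} = ⊤) {k : ℕ} (hk : powWedge A g k ∈ W) : ⋀[A]^k N ≤ W := by
  suffices hmul : ∀ d j, j + d = k → ∀ β ∈ ⋀[A]^d N, powWedge A g j * β ∈ W by
    intro β hβ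
    simpa only [powWedge, one_mul] using hmul k 0 (zero_add k) β hβ
  intro d
  induction d with
  | zero =>
    rintro j rfl β hβ
    obtain ⟨a, rfl⟩ := Submodule.mem_one.1 hβ
    rw [← Algebra.commutes, ← Algebra.smul_def]
    exact W.smul_mem a hk
  | succ d ih =>
    intro j hj β hβ
    rw [ExteriorAlgebra.exteriorPower, pow_succ'] at hβ
    induction hβ using Submodule.mul_induction_on' with
    | mem_mul_mem b hb γ hγ =>
      obtain ⟨m, rfl⟩ := hb
      obtain ⟨q, rfl⟩ := Submodule.mem_span_singleton.1 (hg.ge (Submodule.mem_top (x := m)))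
      exact powWedge_mul_ι_mul_mem hW g
        (fun h => ih (j + 1) (by omega) _ (E_mem A N d h γ hγ)) q
    | add β _ β' _ hβ hβ' =>
      rw [mul_add]
      exact add_mem hβ hβ'

theorem opEval_eq_zero_of_apply_powWedge {g : N} (hg : Submodule.span A[X] {g} = ⊤) {k : ℕ}
    {f : MvPolynomial (Fin k) A} (hf : opEval A N k f ⟨powWedge A g k, powWedge_mem A g k⟩ = 0) :
    opEval A N k f = 0 := by
  have hstable : ∀ h, ∀ w ∈ (LinearMap.ker (opEval A N k f)).map (⋀[A]^k N).subtype,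
      D A N h w ∈ (LinearMap.ker (opEval A N k f)).map (⋀[A]^k N).subtype := by
    rintro h _ ⟨α, hα, rfl⟩
    refine ⟨DRes A N k h α, ?_, rfl⟩
    rw [SetLike.mem_coe, LinearMap.mem_ker] at hα ⊢
    rw [← opEval_Dtilde, ← Module.End.mul_apply, ← map_mul, mul_comm, map_mul,
      Module.End.mul_apply, hα, map_zero]
  refine LinearMap.ext fun α => ?_
  obtain ⟨β, hβ, hβα⟩ := exteriorPower_le_of_powWedge_mem hstable hg ⟨_, hf, rfl⟩ α.2
  rwa [← Subtype.ext hβα]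

end CyclicModules

section Relations

variable {A : Type*} [CommRing A]

theorem sum_coeff_reflect_smul {M : Type*} [AddCommGroup M] [Module A M] (F : A[X] →ₗ[A] M)
    {j : ℕ} (hF : ∀ i < j, F (X ^ i) = 0) {n m : ℕ} (hn : n ≤ m + j) {q : A[X]}
    (hq : q.natDegree ≤ n) :
    ∑ x ∈ Finset.HasAntidiagonal.antidiagonal m, (reflect n q).coeff x.1 • F (X ^ (j + x.2)) =
      F (X ^ (m + j - n) * q) := by
  refine Polynomial.induction_with_natDegree_le
    (motive := fun q => ∑ x ∈ Finset.HasAntidiagonal.antidiagonal m,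
      (reflect n q).coeff x.1 • F (X ^ (j + x.2)) = F (X ^ (m + j - n) * q))
    n ?_ (fun e a _ he => ?_) (fun q r _ _ hq hr => ?_) q hq
  · simp
  · simp only [reflect_C_mul_X_pow, revAt_le he, coeff_C_mul_X_pow, ite_smul, zero_smul]
    rw [← Finset.sum_filter, Finset.HasAntidiagonal.filter_fst_eq_antidiagonal m (n - e),
      ← smul_eq_C_mul, mul_smul_comm, ← pow_add, map_smul]
    split_ifs with hem
    · rw [Finset.sum_singleton]
      congr 3
      omega
    · rw [Finset.sum_empty, hF _ (by omega), smul_zero]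
  · simp only [reflect_add, coeff_add, add_smul, Finset.sum_add_distrib]
    rw [hq, hr, mul_add, map_add]

theorem coeff_reverse_eq_lowCoeff (p : A[X]) (i : ℕ) : p.reverse.coeff i = lowCoeff p i := by
  rw [coeff_reverse, lowCoeff]
  split_ifs with hi
  · rw [revAt_le hi]
  · rw [revAt_eq_self_of_lt (not_le.1 hi), coeff_eq_zero_of_natDegree_lt (not_le.1 hi)]

theorem DtildeP_eq_sum {p : A[X]} (hp : p.Monic) (k m : ℕ) :
    DtildeP p k m = ∑ x ∈ Finset.HasAntidiagonal.antidiagonal m,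
      MvPolynomial.C (p.reverse.coeff x.1) * Dtilde A k x.2 := by
  rw [Finset.Nat.sum_antidiagonal_eq_sum_range_succ fun i j =>
      MvPolynomial.C (p.reverse.coeff i) * Dtilde A k j, DtildeP, Finset.sum_range_succ',
    coeff_zero_reverse, hp.leadingCoeff, map_one, one_mul, Nat.sub_zero, add_comm,
    Finset.range_eq_Ico, Finset.sum_Ico_add' (fun i =>
      MvPolynomial.C (p.reverse.coeff i) * Dtilde A k (m - i)) 0 m 1, zero_add,
    Finset.Ico_add_one_right_eq_Icc]
  simp only [coeff_reverse_eq_lowCoeff]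

variable {N : Type*} [AddCommGroup N] [Module A N] [Module A[X] N] [IsScalarTower A A[X] N]

theorem sum_coeff_reflect_smul_D_powWedge {g : N} {q : A[X]} (hqg : q • g = 0) {n m k : ℕ}
    (hn : n < m + k) (hq : q.natDegree ≤ n) :
    ∑ x ∈ Finset.HasAntidiagonal.antidiagonal m,
      (reflect n q).coeff x.1 • D A N x.2 (powWedge A g k) = 0 := by
  rcases k with _ | k
  · have hm : (reflect n q).coeff m = 0 := by
      rw [add_zero] at hn
      rw [coeff_reflect, revAt_eq_self_of_lt hn, coeff_eq_zero_of_natDegree_lt (hq.trans_lt hn)]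
    simp only [powWedge, D_one, smul_ite, smul_zero]
    rw [← Finset.sum_filter, Finset.HasAntidiagonal.filter_snd_eq_antidiagonal m 0,
      if_pos m.zero_le, Finset.sum_singleton, Nat.sub_zero, hm, zero_smul]
  · let F : A[X] →ₗ[A] ExteriorAlgebra A N := LinearMap.mulLeft A (powWedge A g k) ∘ₗ
      ExteriorAlgebra.ι A ∘ₗ (LinearMap.toSpanSingleton A[X] N g).restrictScalars A
    have hF : ∀ i < k, F (X ^ i) = 0 := fun i hi => powWedge_mul_ι_of_lt A g hi
    have hsum := sum_coeff_reflect_smul F hF (Nat.lt_succ_iff.1 hn) hq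
    have hzero : F (X ^ (m + k - n) * q) = 0 := by
      change _ * ExteriorAlgebra.ι A ((X ^ (m + k - n) * q) • g) = 0
      rw [mul_smul, hqg, smul_zero, map_zero, mul_zero]
    rw [hzero] at hsum
    simp only [D_powWedge_succ]
    exact hsum

theorem relIdeal_le_ker_opEval {p : A[X]} (hp : p.Monic) {g : N}
    (hg : Submodule.span A[X] {g} = ⊤) (hpg : p • g = 0) {k : ℕ} (hk : k ≤ p.natDegree) :
    relIdeal p k ≤ RingHom.ker (opEval A N k) := by
  refine Ideal.span_le.2 ?_
  rintro _ ⟨j, hj, -, rfl⟩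
  refine opEval_eq_zero_of_apply_powWedge hg (Subtype.ext ?_)
  rw [DtildeP_eq_sum hp, map_sum, LinearMap.sum_apply, Submodule.coe_sum]
  refine (Finset.sum_congr rfl fun x _ => ?_).trans (sum_coeff_reflect_smul_D_powWedge hpg
    (m := p.natDegree - k + j) (k := k) (by omega) le_rfl)
  rw [map_mul, ← MvPolynomial.algebraMap_eq, AlgHom.commutes, opEval_Dtilde, ← Algebra.smul_def]
  rfl

end Relations

section DeterminantFunctional

theorem coeff_det_add_X_smul {n R : Type*} [Fintype n] [DecidableEq n] [CommRing R]
    (v w : n → n → R) (h : ℕ) :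
    ((Matrix.of v).map C + (X : R[X]) • (Matrix.of w).map C).det.coeff h =
      ∑ s ∈ Finset.powersetCard h Finset.univ, (Matrix.of (s.piecewise w v)).det := by
  have hpiece (s : Finset n) : Matrix.detRowAlternating
      (s.piecewise (fun i j => X * C (w i j)) fun i j => C (v i j)) =
        monomial s.card (Matrix.of (s.piecewise w v)).det := by
    have hrows : (s.piecewise (fun i j => X * C (w i j)) fun i j => C (v i j)) =
        s.piecewise (fun i => (X : R[X]) • fun j => C (s.piecewise w v i j))
          fun i j => C (s.piecewise w v i j) := by
      ext1 i
      by_cases hi : i ∈ s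
      · simp only [Finset.piecewise_eq_of_mem _ _ _ hi]
        rfl
      · simp only [Finset.piecewise_eq_of_notMem _ _ _ hi]
    rw [hrows, ← C_mul_X_pow_eq_monomial, mul_comm, ← Finset.prod_const, RingHom.map_det]
    exact Matrix.detRowAlternating.toMultilinearMap.map_piecewise_smul _ _ s
  have hdet : ((Matrix.of v).map C + (X : R[X]) • (Matrix.of w).map C).det =
      ∑ s : Finset n, monomial s.card (Matrix.of (s.piecewise w v)).det := by
    rw [add_comm]
    exact (Matrix.detRowAlternating.toMultilinearMap.map_add_univ _ _).trans
      (Finset.sum_congr rfl fun s _ => hpiece s)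
  rw [hdet, finsetSum_coeff, Finset.powersetCard_eq_filter, Finset.sum_filter,
    Finset.powerset_univ]
  simp only [coeff_monomial]

variable {A N S : Type*} [CommRing A] [AddCommGroup N] [Module A N] [CommRing S] [Algebra A S]
  {k : ℕ}

/-- The linear form `v_1 ∧ … ∧ v_k ↦ det (F v_1, …, F v_k)` on `⋀^k N` attached to a linear map
`F : N → S^k`. -/
def detForm (F : N →ₗ[A] Fin k → S) : ⋀[A]^k N →ₗ[A] S :=
  exteriorPower.alternatingMapLinearEquiv
    { Matrix.detRowAlternating.toMultilinearMap.restrictScalars A |>.compLinearMap fun _ => F with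
      map_eq_zero_of_eq' := fun v _ _ hv hij =>
        Matrix.detRowAlternating.map_eq_zero_of_eq (fun i => F (v i)) (congrArg F hv) hij }

theorem detForm_ιMulti (F : N →ₗ[A] Fin k → S) (v : Fin k → N) :
    detForm F (exteriorPower.ιMulti A k v) = (Matrix.of fun i => F (v i)).det := by
  rw [detForm, exteriorPower.alternatingMapLinearEquiv_apply_ιMulti]
  rfl

variable [Module A[X] N] [IsScalarTower A A[X] N] {F : N →ₗ[A] Fin k → S}
  {Q : Matrix (Fin k) (Fin k) S}

theorem detForm_ERes (hF : ∀ m, F ((X : A[X]) • m) = F m ᵥ* Q) (h : ℕ) (α : ⋀[A]^k N) :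
    detForm F (ERes A N k h α) = Q.charpolyRev.coeff h * detForm F α := by
  suffices hmaps : detForm F ∘ₗ ERes A N k h = Q.charpolyRev.coeff h • detForm F from
    LinearMap.congr_fun hmaps α
  refine exteriorPower.linearMap_ext (AlternatingMap.ext fun v => ?_)
  let M : Matrix (Fin k) (Fin k) S := Matrix.of fun i => F (v i)
  have hfactor : M.map C + (X : S[X]) • (Matrix.of fun i => F (-((X : A[X]) • v i))).map C =
      M.map C * (1 - (X : S[X]) • Q.map C) := by
    have hMQ : (Matrix.of fun i => F (-((X : A[X]) • v i))) = -(M * Q) := by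
      ext i j
      simp only [map_neg, hF]
      rfl
    rw [hMQ, Matrix.map_neg C (map_neg C), Matrix.map_mul, smul_neg, mul_sub, mul_one,
      Matrix.mul_smul, sub_eq_add_neg]
  calc detForm F (ERes A N k h (exteriorPower.ιMulti A k v))
      = ∑ s ∈ Finset.powersetCard h Finset.univ, (Matrix.of
          (s.piecewise (fun i => F (-((X : A[X]) • v i))) fun i => F (v i))).det := by
        rw [ERes_ιMulti, map_sum]
        refine Finset.sum_congr rfl fun s _ => ?_
        rw [detForm_ιMulti]
        congr 2
        ext1 i
        exact apply_ite F (i ∈ s) _ _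
    _ = (C M.det * Q.charpolyRev).coeff h := by
        rw [← coeff_det_add_X_smul, hfactor, Matrix.det_mul, RingHom.map_det]
        rfl
    _ = Q.charpolyRev.coeff h * detForm F (exteriorPower.ιMulti A k v) := by
        rw [coeff_C_mul, mul_comm, detForm_ιMulti]

variable {ψ : MvPolynomial (Fin k) A →ₐ[A] S}

theorem detForm_DRes (hF : ∀ m, F ((X : A[X]) • m) = F m ᵥ* Q)
    (hψ : PowerSeries.map ψ.toRingHom (denomSeries A k) = Q.charpolyRev) (h : ℕ)
    (α : ⋀[A]^k N) :
    detForm F (DRes A N k h α) = ψ (Dtilde A k h) * detForm F α := by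
  let σ : PowerSeries S := PowerSeries.mk fun h => detForm F (DRes A N k h α)
  have hσ : PowerSeries.map ψ.toRingHom (denomSeries A k) * σ = PowerSeries.C (detForm F α) := by
    ext h
    have hED := congrArg (detForm F) <| LinearMap.congr_fun
      (congrArg (PowerSeries.coeff h) (mk_ERes_mul_mk_DRes A N k)) α
    rw [PowerSeries.coeff_mul, LinearMap.sum_apply, map_sum] at hED
    simp only [PowerSeries.coeff_mk, Module.End.mul_apply, detForm_ERes hF] at hED
    rw [hψ, PowerSeries.coeff_mul, PowerSeries.coeff_C]
    simp only [Polynomial.coeff_coe, σ, PowerSeries.coeff_mk]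
    rw [hED, PowerSeries.coeff_one]
    split_ifs
    · rfl
    · exact map_zero _
  have hσ' : σ = PowerSeries.map ψ.toRingHom (PowerSeries.mk (Dtilde A k)) *
      PowerSeries.C (detForm F α) := by
    rw [← hσ, ← mul_assoc, ← map_mul, mk_Dtilde_mul_denomSeries, map_one, one_mul]
  have hcoeff := congrArg (PowerSeries.coeff h) hσ'
  rwa [PowerSeries.coeff_mul_C, PowerSeries.coeff_map, PowerSeries.coeff_mk,
    PowerSeries.coeff_mk] at hcoeff

theorem detForm_opEval (hF : ∀ m, F ((X : A[X]) • m) = F m ᵥ* Q)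
    (hψ : PowerSeries.map ψ.toRingHom (denomSeries A k) = Q.charpolyRev)
    (f : MvPolynomial (Fin k) A) (α : ⋀[A]^k N) :
    detForm F (opEval A N k f α) = ψ f * detForm F α := by
  induction f using MvPolynomial.induction_on generalizing α with
  | C a =>
    rw [← MvPolynomial.algebraMap_eq, AlgHom.commutes, AlgHom.commutes, Module.algebraMap_end_apply,
      map_smul, Algebra.smul_def]
  | add f f' hf hf' => rw [map_add, LinearMap.add_apply, map_add, map_add, hf, hf', add_mul]
  | mul_X f i hf =>
    rw [map_mul, Module.End.mul_apply, hf, opEval_X, detForm_DRes hF hψ, Dtilde_succ, map_mul,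
      mul_assoc]

theorem exists_linearMap_apply_smul_eq_aeval {B : Type*} [Ring B] [Algebra A B] {g : N}
    (hg : Submodule.span A[X] {g} = ⊤) {b : B} (hb : ∀ q : A[X], q • g = 0 → aeval b q = 0) :
    ∃ F : N →ₗ[A] B, ∀ q : A[X], F (q • g) = aeval b q := by
  let G : A[X] →ₗ[A] N := (LinearMap.toSpanSingleton A[X] N g).restrictScalars A
  have hG : Function.Surjective G := fun m => Submodule.mem_span_singleton.1 (hg.ge trivial)
  let F := (LinearMap.ker G).liftQ (aeval b).toLinearMap fun q hq => hb q hq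
  refine ⟨F ∘ₗ (G.quotKerEquivOfSurjective hG).symm.toLinearMap, fun q => ?_⟩
  have hq : (G.quotKerEquivOfSurjective hG).symm (q • g) = Submodule.Quotient.mk q :=
    (LinearEquiv.symm_apply_eq _).2 rfl
  rw [LinearMap.comp_apply, LinearEquiv.coe_coe, hq]
  rfl

theorem exists_linearMap_vecMul_leftMulMatrix {B : Type*} [CommRing B] [Algebra A B] [Algebra S B]
    [IsScalarTower A S B] (pb : PowerBasis S B) {g : N} (hg : Submodule.span A[X] {g} = ⊤)
    (hb : ∀ q : A[X], q • g = 0 → aeval pb.gen q = 0) :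
    ∃ F : N →ₗ[A] Fin pb.dim → S,
      (∀ m, F ((X : A[X]) • m) = F m ᵥ* (Algebra.leftMulMatrix pb.basis pb.gen)ᵀ) ∧
      ∀ i : Fin pb.dim, F ((X : A[X]) ^ (i : ℕ) • g) = Pi.single i 1 := by
  obtain ⟨F, hF⟩ := exists_linearMap_apply_smul_eq_aeval hg hb
  refine ⟨(pb.basis.equivFun.restrictScalars A).toLinearMap ∘ₗ F, fun m => ?_, fun i => ?_⟩
  · obtain ⟨q, rfl⟩ := Submodule.mem_span_singleton.1 (hg.ge (Submodule.mem_top (x := m)))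
    have hrepr := Algebra.leftMulMatrix_mulVec_repr pb.basis pb.gen (aeval pb.gen q)
    rw [Matrix.vecMul_transpose, smul_smul, LinearMap.comp_apply, LinearMap.comp_apply, hF, hF,
      map_mul, aeval_X]
    exact hrepr.symm
  · rw [LinearMap.comp_apply, hF, aeval_X_pow, ← pb.basis_eq_pow]
    exact (DFunLike.coe_fn_eq.2 (pb.basis.repr_self i)).trans (Finsupp.single_eq_pi_single i 1)

theorem minpoly_root_eq_self {e : S[X]} (he : e.Monic) : minpoly S (AdjoinRoot.root e) = e := by
  refine (minpoly.unique' S _ he ?_ fun q hq => or_iff_not_imp_left.2 fun hq0 => ?_).symm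
  · rw [AdjoinRoot.aeval_eq, AdjoinRoot.mk_self]
  · rw [AdjoinRoot.aeval_eq, Ne, AdjoinRoot.mk_eq_zero]
    exact he.not_dvd_of_degree_lt hq0 hq

theorem eq_zero_of_opEval_eq_zero_of_charpolyRev (hF : ∀ m, F ((X : A[X]) • m) = F m ᵥ* Q)
    (hψ : PowerSeries.map ψ.toRingHom (denomSeries A k) = Q.charpolyRev) {g : N}
    (hFg : ∀ i : Fin k, F ((X : A[X]) ^ (i : ℕ) • g) = Pi.single i 1)
    {f : MvPolynomial (Fin k) A} (hf : opEval A N k f = 0) : ψ f = 0 := by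
  have hone : detForm F ⟨powWedge A g k, powWedge_mem A g k⟩ = 1 := by
    have hwedge : (⟨powWedge A g k, powWedge_mem A g k⟩ : ⋀[A]^k N) =
        exteriorPower.ιMulti A k fun i => (X : A[X]) ^ (i : ℕ) • g :=
      Subtype.ext (powWedge_eq_ιMulti A g k)
    have hmatrix : (Matrix.of fun i : Fin k => F ((X : A[X]) ^ (i : ℕ) • g)) = 1 := by
      ext i j
      rw [Matrix.of_apply, hFg, Matrix.one_apply, Pi.single_apply]
      exact if_congr eq_comm rfl rfl
    rw [hwedge, detForm_ιMulti, hmatrix, Matrix.det_one]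
  have hzero := detForm_opEval hF hψ f ⟨powWedge A g k, powWedge_mem A g k⟩
  rwa [hf, LinearMap.zero_apply, map_zero, hone, mul_one, eq_comm] at hzero

theorem eq_zero_of_opEval_eq_zero {e : S[X]} (he : e.Monic) (hek : e.natDegree = k)
    (hψ : PowerSeries.map ψ.toRingHom (denomSeries A k) = e.reverse) {g : N}
    (hg : Submodule.span A[X] {g} = ⊤)
    (hge : ∀ q : A[X], q • g = 0 → e ∣ q.map (algebraMap A S)) {f : MvPolynomial (Fin k) A}
    (hf : opEval A N k f = 0) : ψ f = 0 := by
  subst hek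
  have hroot (q : A[X]) (hq : q • g = 0) : aeval (AdjoinRoot.powerBasis' he).gen q = 0 := by
    rw [AdjoinRoot.powerBasis'_gen, ← aeval_map_algebraMap S, AdjoinRoot.aeval_eq,
      AdjoinRoot.mk_eq_zero]
    exact hge q hq
  obtain ⟨F, hF, hFg⟩ := exists_linearMap_vecMul_leftMulMatrix (AdjoinRoot.powerBasis' he) hg hroot
  refine eq_zero_of_opEval_eq_zero_of_charpolyRev hF ?_ hFg hf
  rw [← Matrix.reverse_charpoly, Matrix.charpoly_transpose, charpoly_leftMulMatrix,
    AdjoinRoot.powerBasis'_gen, minpoly_root_eq_self he]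
  exact hψ

end DeterminantFunctional

section GenericDivisor

theorem reflect_dvd_reflect {S : Type*} [CommRing S] {d r : S[X]} {k n : ℕ}
    (hd : d.natDegree ≤ k) (hr : r.natDegree ≤ n) (hkn : k ≤ n) {q : PowerSeries S}
    (hq : (d : PowerSeries S) * q = r)
    (hvanish : ∀ m, n - k < m → m ≤ n → PowerSeries.coeff m q = 0) :
    reflect k d ∣ reflect n r := by
  have hdeg : (PowerSeries.trunc (n - k + 1) q).natDegree ≤ n - k :=
    Nat.lt_succ_iff.1 (PowerSeries.natDegree_trunc_lt q (n - k))
  have hcoeff : ∀ m ≤ n, (PowerSeries.trunc (n - k + 1) q).coeff m = PowerSeries.coeff m q := by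
    intro m hm
    rw [PowerSeries.coeff_trunc]
    split_ifs with hmk
    · rfl
    · exact (hvanish m (by omega) hm).symm
  have hmul : d * PowerSeries.trunc (n - k + 1) q = r := by
    ext m
    rcases le_or_gt m n with hm | hm
    · rw [← Polynomial.coeff_coe r, ← hq, Polynomial.coeff_mul, PowerSeries.coeff_mul]
      refine Finset.sum_congr rfl fun x hx => ?_
      rw [hcoeff _ ((Finset.HasAntidiagonal.antidiagonal.snd_le hx).trans hm), Polynomial.coeff_coe]
    · rw [coeff_eq_zero_of_natDegree_lt (hr.trans_lt hm), coeff_eq_zero_of_natDegree_lt]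
      exact (natDegree_mul_le.trans (add_le_add hd hdeg)).trans_lt (by omega)
  rw [← hmul, ← Nat.add_sub_cancel' hkn, reflect_mul _ _ hd (by simpa using hdeg)]
  exact dvd_mul_right _ _

variable (A : Type*) [CommRing A] (k : ℕ)

/-- The generic monic polynomial `X ^ k - Δ_1 X ^ (k - 1) + … + (-1) ^ k Δ_k` over
`A[T_1, …, T_k]`. -/
def genericDivisor : (MvPolynomial (Fin k) A)[X] :=
  reflect k (PowerSeries.trunc (k + 1) (denomSeries A k))

theorem natDegree_trunc_denomSeries_le :
    (PowerSeries.trunc (k + 1) (denomSeries A k)).natDegree ≤ k :=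
  Nat.lt_succ_iff.1 (PowerSeries.natDegree_trunc_lt _ k)

theorem coe_trunc_denomSeries :
    (PowerSeries.trunc (k + 1) (denomSeries A k) : PowerSeries (MvPolynomial (Fin k) A)) =
      denomSeries A k := by
  ext1 h
  rw [Polynomial.coeff_coe, PowerSeries.coeff_trunc]
  split_ifs with hh
  · rfl
  · rw [coeff_denomSeries_of_lt A (by omega)]

theorem natDegree_genericDivisor_le : (genericDivisor A k).natDegree ≤ k :=
  (natDegree_reflect_le).trans (max_le le_rfl (natDegree_trunc_denomSeries_le A k))

theorem coeff_genericDivisor_self : (genericDivisor A k).coeff k = 1 := by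
  rw [genericDivisor, coeff_reflect, revAt_le le_rfl, Nat.sub_self, PowerSeries.coeff_trunc,
    if_pos k.succ_pos, coeff_zero_denomSeries]

theorem monic_genericDivisor : (genericDivisor A k).Monic :=
  monic_of_natDegree_le_of_coeff_eq_one k (natDegree_genericDivisor_le A k)
    (coeff_genericDivisor_self A k)

theorem natDegree_genericDivisor [Nontrivial A] : (genericDivisor A k).natDegree = k :=
  natDegree_eq_of_le_of_coeff_ne_zero (natDegree_genericDivisor_le A k)
    (by rw [coeff_genericDivisor_self]; exact one_ne_zero)

variable {A k} {S : Type*} [CommRing S] [Algebra A S] (ψ : MvPolynomial (Fin k) A →ₐ[A] S)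

theorem natDegree_map_genericDivisor [Nontrivial S] :
    ((genericDivisor A k).map ψ.toRingHom).natDegree = k := by
  have := (algebraMap A S).domain_nontrivial
  rw [(monic_genericDivisor A k).natDegree_map, natDegree_genericDivisor]

theorem coe_reverse_map_genericDivisor [Nontrivial S] :
    (((genericDivisor A k).map ψ.toRingHom).reverse : PowerSeries S) =
      PowerSeries.map ψ.toRingHom (denomSeries A k) := by
  rw [reverse, natDegree_map_genericDivisor, reflect_map, genericDivisor, reflect_reflect,
    polynomial_map_coe, coe_trunc_denomSeries]

theorem denomSeries_mul_mk_DtildeP {p : A[X]} (hp : p.Monic) :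
    denomSeries A k * PowerSeries.mk (DtildeP p k) =
      (p.reverse.map MvPolynomial.C : (MvPolynomial (Fin k) A)[X]) := by
  have hmk : PowerSeries.mk (DtildeP p k) =
      (p.reverse.map MvPolynomial.C : (MvPolynomial (Fin k) A)[X]) *
        PowerSeries.mk (Dtilde A k) := by
    ext1 m
    rw [PowerSeries.coeff_mk, DtildeP_eq_sum hp, PowerSeries.coeff_mul]
    simp only [Polynomial.coeff_coe, coeff_map, PowerSeries.coeff_mk]
  rw [hmk, mul_comm, mul_assoc, mk_Dtilde_mul_denomSeries, mul_one]

theorem map_genericDivisor_dvd_map {p : A[X]} (hp : p.Monic) (hk : k ≤ p.natDegree)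
    (hψ : ∀ f ∈ relIdeal p k, ψ f = 0) :
    (genericDivisor A k).map ψ.toRingHom ∣ p.map (algebraMap A S) := by
  have hC : ψ.toRingHom.comp MvPolynomial.C = algebraMap A S := ψ.comp_algebraMap
  have hq := congrArg (PowerSeries.map ψ.toRingHom) (denomSeries_mul_mk_DtildeP (k := k) hp)
  rw [map_mul, ← coe_trunc_denomSeries, ← polynomial_map_coe, ← polynomial_map_coe,
    map_map, hC] at hq
  have hvanish : ∀ m, p.natDegree - k < m → m ≤ p.natDegree → PowerSeries.coeff m
      (PowerSeries.map ψ.toRingHom (PowerSeries.mk (DtildeP p k))) = 0 := fun m hkm hm => by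
    rw [PowerSeries.coeff_map, PowerSeries.coeff_mk]
    exact hψ _ (Ideal.subset_span ⟨m - (p.natDegree - k), by omega, by omega,
      congrArg _ (by omega)⟩)
  have hdvd := reflect_dvd_reflect (natDegree_map_le.trans (natDegree_trunc_denomSeries_le A k))
    (natDegree_map_le.trans (reverse_natDegree_le p)) hk hq hvanish
  rwa [reflect_map, reflect_map, reverse, reflect_reflect] at hdvd

end GenericDivisor

section CanonicalGenerator

variable {A : Type*} [CommRing A] (p : A[X])

theorem span_eps_one : Submodule.span A[X] {eps p 1 le_rfl} = ⊤ := by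
  refine eq_top_iff.2 fun m _ => ?_
  obtain ⟨⟨f, hf⟩, rfl⟩ := Submodule.Quotient.mk_surjective _ m
  obtain ⟨q, rfl⟩ := Ideal.mem_span_singleton'.1 hf
  refine Submodule.mem_span_singleton.2 ⟨q, ?_⟩
  rw [eps, ← Submodule.Quotient.mk_smul]
  exact congrArg _ (Subtype.ext (by simp))

variable {p}

theorem smul_eps_one_eq_zero_iff {q : A[X]} : q • eps p 1 le_rfl = 0 ↔ p ∣ q := by
  rw [eps, ← Submodule.Quotient.mk_smul, Submodule.Quotient.mk_eq_zero,
    Submodule.mem_smul_pointwise_iff_exists]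
  constructor
  · rintro ⟨⟨f, hf⟩, -, hpf⟩
    obtain ⟨r, rfl⟩ := Ideal.mem_span_singleton'.1 hf
    have hX : p * r * X = q * X := by simpa [mul_assoc] using congrArg Subtype.val hpf
    exact ⟨r, (isRegular_X.right hX).symm⟩
  · rintro ⟨r, rfl⟩
    rw [mul_smul]
    exact ⟨_, Submodule.mem_top, rfl⟩

theorem ker_opEval_modP (hp : p.Monic) {k : ℕ} (hk : k ≤ p.natDegree) :
    RingHom.ker (opEval A (ModP p) k) = relIdeal p k := by
  refine le_antisymm (fun f hf => ?_)
    (relIdeal_le_ker_opEval hp (span_eps_one p) (smul_eps_one_eq_zero_iff.2 dvd_rfl) hk)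
  let ψ := Ideal.Quotient.mkₐ A (relIdeal p k)
  rw [← Ideal.Quotient.eq_zero_iff_mem]
  nontriviality MvPolynomial (Fin k) A ⧸ relIdeal p k
  have hdvd : (genericDivisor A k).map ψ.toRingHom ∣ p.map (algebraMap A _) :=
    map_genericDivisor_dvd_map ψ hp hk fun f hf => Ideal.Quotient.eq_zero_iff_mem.2 hf
  exact eq_zero_of_opEval_eq_zero (ψ := ψ) ((monic_genericDivisor A k).map _)
    (natDegree_map_genericDivisor ψ) (coe_reverse_map_genericDivisor ψ).symm (span_eps_one p)
    (fun q hq => hdvd.trans (Polynomial.map_dvd _ (smul_eps_one_eq_zero_iff.1 hq))) hf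

theorem opEval_modP_zero_injective (k : ℕ) :
    Function.Injective (opEval A (ModP (0 : A[X])) k) := by
  nontriviality A
  refine (injective_iff_map_eq_zero _).2 fun f hf => ?_
  let ψ := AlgHom.id A (MvPolynomial (Fin k) A)
  refine eq_zero_of_opEval_eq_zero (ψ := ψ) ((monic_genericDivisor A k).map _)
    (natDegree_map_genericDivisor ψ) (coe_reverse_map_genericDivisor ψ).symm (span_eps_one 0)
    (fun q hq => ?_) hf
  rw [zero_dvd_iff.1 (smul_eps_one_eq_zero_iff.1 hq), Polynomial.map_zero]
  exact dvd_zero _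

end CanonicalGenerator

end SchubertCalculus

end

theorem mainTheorem1 {A : Type*} [CommRing A] (p : Polynomial A) (hp : p.Monic)
    (k : ℕ) (hk : k ≤ p.natDegree) :
    (∃ Ψ : MvPolynomial (Fin k) A ≃ₐ[A] SchubertCalculus.OperatorRing (0 : Polynomial A) k,
      ∀ i : Fin k,
        (Ψ (MvPolynomial.X i) :
            Module.End A (⋀[A]^k (SchubertCalculus.ModP (0 : Polynomial A)))) =
          SchubertCalculus.DRes A (SchubertCalculus.ModP (0 : Polynomial A)) k ((i : ℕ) + 1)) ∧
    (∃ Φ : (MvPolynomial (Fin k) A ⧸ SchubertCalculus.relIdeal p k) ≃ₐ[A]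
        SchubertCalculus.OperatorRing p k,
      ∀ i : Fin k,
        (Φ (Ideal.Quotient.mk (SchubertCalculus.relIdeal p k) (MvPolynomial.X i)) :
            Module.End A (⋀[A]^k (SchubertCalculus.ModP p))) =
          SchubertCalculus.DRes A (SchubertCalculus.ModP p) k ((i : ℕ) + 1)) :=
  open SchubertCalculus in
  ⟨exists_algEquiv_opRing_of_injective A _ k (opEval_modP_zero_injective k),
    exists_algEquiv_opRing_of_ker_eq A _ k (ker_opEval_modP hp hk)⟩
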